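/- **Notation.** For $0<q<1$ let $[n]_q=1+q+\dots+q^{n-1}$, $[n]_q!=[1]_q[2]_q\cdots[n]_q$ (with $[0]_q!=1$), $\left[{n\atop k}\right]_q=\frac{[n]_q!}{[k]_q!\,[n-k]_q!}$, $(1+x)_q^m=\prod_{j=0}^{m-1}(1+q^jx)$, $e_q^{z}=\prod_{j\ge 0}\bigl(1-(1-q)q^jz\bigr)^{-1}$, and for $B>0$ let $\int_0^{\infty/B}g(t)\,d_qt=(1-q)\sum_{j\in\mathbb Z}\frac{q^j}{B}\,g\!\left(\frac{q^j}{B}\right)$ (improper Jackson integral). Fix $A>0$ and an integer $p\ge 0$. For $n\ge 1$, $x\ge 0$ and bounded $f:[0,\infty)\to\mathbb R$ the $q$-Baskakov–Schurer–Szász operator is $$\mathcal L^{q}_{n,p}(f,x)=[n+p]_q\sum_{k=0}^\infty \left[{n+p+k-1\atop k}\right]_q q^{k^2}\frac{x^k}{(1+x)_q^{n+p+k}}\int_0^{\frac{\infty}{A(1-q)}} f(t)\,e_q^{-[n+p]_qt}\,\frac{([n+p]_qt)^k}{[k]_q!}\,d_qt .$$ A real sequence $(x_n)_{n\ge1}$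 satisfies $st\text{-}\lim_n x_n=l$ if for every $\varepsilon>0$, $\lim_{N}\frac1N\left|\{j\le N: |x_j-l|\ge\varepsilon\}\right|=0$. Let $\rho(x)=1+x^2$ and $\|g\|_\rho=\sup_{x\ge0}|g(x)|/\rho(x)$. $C_B[0,\infty)$ is the space of bounded continuous functions on $[0,\infty)$; for $\nu>0$, $C[0,\nu]$ is the space of bounded functions $f:[0,\infty)\to\mathbb R$ which are continuous (as functions on $[0,\infty)$) at every point of $[0,\nu]$, and $\|g\|_{C[0,\nu]}=\sup_{0\le x\le\nu}|g(x)|$. **Theorem.** Let $q=(q_n)_{n\ge1}$, $0<q_n<1$, satisfy, for some $a<1$, $$st\text{-}\lim_n q_n=1,\qquad st\text{-}\lim_n q_n^n=a,\qquad st\text{-}\lim_n\frac1{[n]_{q_n}}=0 .$$ 1. For every $f\in C_B[0,\infty)$, the series defining $\mathcal L^{q_n}_{n,p}(f,x)$ converge absolutely for all $n\ge1$, $x\ge0$, $\|\mathcal L^{q_n}_{n,p}(f,\cdot)-f\|_\rho$ is finite for all $n\ge 1$, and $$st\text{-}\lim_n\|\mathcal L^{q_n}_{n,p}(f,\cdot)-f\|_\rho=0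 .$$ 2. For every $\nu>0$ and every $f\in C[0,\nu]$, the series defining $\mathcal L^{q_n}_{n,p}(f,x)$ converge absolutely for all $n\ge1$, $x\ge0$, $\|\mathcal L^{q_n}_{n,p}(f,\cdot)-f\|_{C[0,\nu]}$ is finite for all $n\ge 1$, and $$st\text{-}\lim_n\|\mathcal L^{q_n}_{n,p}(f,\cdot)-f\|_{C[0,\nu]}=0 .$$ -/

import Mathlib

open Filter Topology

namespace QBaskakov

noncomputable section

/-- The `q`-integer `[n]_q = 1 + q + ⋯ + q^(n-1)`. -/
def qInt (q : ℝ) (n : ℕ) : ℝ := ∑ i ∈ Finset.range n, q ^ i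

/-- The `q`-factorial `[n]_q! = [1]_q [2]_q ⋯ [n]_q`, with `[0]_q! = 1`. -/
def qFactorial (q : ℝ) (n : ℕ) : ℝ := ∏ i ∈ Finset.range n, qInt q (i + 1)

/-- The `q`-binomial coefficient (used for `k ≤ n` only). -/
def qBinom (q : ℝ) (n k : ℕ) : ℝ :=
  qFactorial q n / (qFactorial q k * qFactorial q (n - k))

/-- The `q`-power `(1 + x)_q^m = (1 + x)(1 + q x) ⋯ (1 + q^(m-1) x)`. -/
def qOnePlusPow (q x : ℝ) (m : ℕ) : ℝ := ∏ j ∈ Finset.range m, (1 + q ^ j * x)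

/-- The `q`-exponential `e_q^z = 1 / ∏_{j ≥ 0} (1 - (1 - q) q^j z)`, for `0 < q < 1`; it is the
continuation of the power series `∑ z^k / [k]_q!`, which converges for `|z| < 1 / (1 - q)`. -/
def qExp (q z : ℝ) : ℝ := (∏' j : ℕ, (1 - (1 - q) * q ^ j * z))⁻¹

/-- The `j`-th term of the improper Jackson integral `∫_0^{∞/B} g(t) d_q t`. -/
def jacksonTerm (q B : ℝ) (g : ℝ → ℝ) (j : ℤ) : ℝ := q ^ j / B * g (q ^ j / B)

/-- The improper Jackson integral
`∫_0^{∞/B} g(t) d_q t = (1 - q) ∑_{j ∈ ℤ} (q^j / B) g(q^j / B)`. -/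
def jacksonIntegral (q B : ℝ) (g : ℝ → ℝ) : ℝ := (1 - q) * ∑' j : ℤ, jacksonTerm q B g j

/-- The `q`-Baskakov–Schurer basis function
`b^k_{n,p}(x; q) = [n+p+k-1 choose k]_q q^(k^2) x^k / (1 + x)_q^(n+p+k)`. -/
def baskakovBasis (q : ℝ) (n p k : ℕ) (x : ℝ) : ℝ :=
  qBinom q (n + p + k - 1) k * q ^ (k ^ 2) * (x ^ k / qOnePlusPow q x (n + p + k))

/-- The `q`-Szász basis function
`s^k_{n,p}(t; q) = e_q^(-[n+p]_q t) ([n+p]_q t)^k / [k]_q!`. -/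
def szaszBasis (q : ℝ) (n p k : ℕ) (t : ℝ) : ℝ :=
  qExp q (-(qInt q (n + p) * t)) * ((qInt q (n + p) * t) ^ k / qFactorial q k)

/-- The `k`-th term
`b^k_{n,p}(x; q) ∫_0^{∞/(A(1-q))} f(t) s^k_{n,p}(t; q) d_q t` of the operator. -/
def operatorTerm (A q : ℝ) (n p : ℕ) (f : ℝ → ℝ) (x : ℝ) (k : ℕ) : ℝ :=
  baskakovBasis q n p k x *
    jacksonIntegral q (A * (1 - q)) (fun t => f t * szaszBasis q n p k t)

/-- The `q`-Baskakov–Schurer–Szász operator `L^q_{n,p}(f, x)`. -/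
def qBSS (A q : ℝ) (n p : ℕ) (f : ℝ → ℝ) (x : ℝ) : ℝ :=
  qInt q (n + p) * ∑' k : ℕ, operatorTerm A q n p f x k

/-- All series that enter `L^q_{n,p}(f, x)` converge (absolutely). -/
def QBSSConverges (A q : ℝ) (n p : ℕ) (f : ℝ → ℝ) (x : ℝ) : Prop :=
  (∀ k : ℕ, Summable (jacksonTerm q (A * (1 - q)) (fun t => f t * szaszBasis q n p k t))) ∧
    Summable (operatorTerm A q n p f x)

/-- `g` is bounded on `S`. -/
def BoundedOn (S : Set ℝ) (g : ℝ → ℝ) : Prop := ∃ M : ℝ, ∀ x ∈ S, |g x| ≤ M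

/-- The space `C_B[0,∞)` of bounded continuous functions on `[0,∞)`
(the values at negative numbers play no role). -/
def MemCB (f : ℝ → ℝ) : Prop :=
  ContinuousOn f (Set.Ici 0) ∧ BoundedOn (Set.Ici 0) f

/-- The space `C[0,ν]` of bounded functions on `[0,∞)` that are continuous at every point
of `[0,ν]`. -/
def MemC (ν : ℝ) (f : ℝ → ℝ) : Prop :=
  (∀ x ∈ Set.Icc 0 ν, ContinuousWithinAt f (Set.Ici 0) x) ∧ BoundedOn (Set.Ici 0) f

/-- The weighted space `B_ρ[0,∞)`, `ρ(x) = 1 + x^2`. -/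
def MemBRho (g : ℝ → ℝ) : Prop := ∃ M : ℝ, ∀ x ∈ Set.Ici (0 : ℝ), |g x| ≤ M * (1 + x ^ 2)

/-- The weighted norm `‖g‖_ρ = sup_{x ≥ 0} |g(x)| / (1 + x^2)`, for `g ∈ B_ρ[0,∞)`. -/
def rhoNorm (g : ℝ → ℝ) : ℝ := ⨆ x : Set.Ici (0 : ℝ), |g x| / (1 + (x : ℝ) ^ 2)

/-- The norm `sup_{0 ≤ x ≤ ν} |g(x)|`, for `g` bounded on `[0,ν]`. -/
def supNorm (ν : ℝ) (g : ℝ → ℝ) : ℝ := ⨆ x : Set.Icc (0 : ℝ) ν, |g x|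

/-- `K ⊆ {1, 2, …}` has natural density `d`. -/
def HasNaturalDensity (K : Set ℕ) (d : ℝ) : Prop :=
  Tendsto (fun n : ℕ => ((K ∩ Set.Icc 1 n).ncard : ℝ) / n) atTop (𝓝 d)

/-- `st-lim_n x_n = l`, for a sequence indexed by `n ≥ 1`. -/
def StatLim (x : ℕ → ℝ) (l : ℝ) : Prop :=
  ∀ ε : ℝ, 0 < ε → HasNaturalDensity {j : ℕ | ε ≤ |x j - l|} 0

end

end QBaskakov

namespace QBaskakov

/-! This is a quantitative Korovkin argument. The operator is positive, fixes constants, and its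
second central moment is an explicit function `centralMoment q s x` with `s = 1 / [n+p]_q`,
vanishing at `q = 1`, `s = 0` and continuous there, uniformly for bounded `x`.

The Jackson moments of `e_q^{-u}` (`hasSum_qExp_moment`) do not depend on the grid, so `A`
disappears. Their powers of `q⁻¹` cancel part of `q^(k^2)` and leave the `q`-Baskakov weights
(`baskakovBasis_mul`), whose total mass and first two factorial moments are computable.

A function in `C[0,ν]` satisfies `|f t - f x| ≤ ε + b (t - x)^2` for all `t ≥ 0`, with `b` uniform
in `x ∈ [0,ν]`. Applying the operator gives `ε + b * centralMoment`. So the error is small whenever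
`q_n` is near `1` and `1/[n]_q` near `0`, and `StatLim.of_two` makes this a statistical limit. For
`‖·‖_ρ`, boundedness of `f` and the growth of `ρ` handle large `x`. -/

theorem hasSum_of_eq {ι : Type*} {f g : ι → ℝ} {a b : ℝ} (h : HasSum f a)
    (hfg : ∀ i, g i = f i) (hab : b = a) : HasSum g b := by
  rw [hab, funext hfg]
  exact h

/-! ### Arithmetic of `q`-integers and `q`-factorials. -/

theorem qInt_succ (q : ℝ) (n : ℕ) : qInt q (n + 1) = 1 + q * qInt q n := by
  simp only [qInt, Finset.sum_range_succ', Finset.mul_sum, pow_succ', pow_zero]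
  ring

theorem qInt_succ' (q : ℝ) (n : ℕ) : qInt q (n + 1) = qInt q n + q ^ n := by
  simp only [qInt, Finset.sum_range_succ]

theorem qInt_nonneg {q : ℝ} (hq : 0 < q) (n : ℕ) : 0 ≤ qInt q n :=
  Finset.sum_nonneg fun _ _ => by positivity

theorem qInt_add (q : ℝ) (m n : ℕ) : qInt q (m + n) = qInt q m + q ^ m * qInt q n := by
  simp only [qInt, Finset.sum_range_add, Finset.mul_sum, pow_add]

theorem qInt_mono {q : ℝ} (hq : 0 < q) {m n : ℕ} (h : m ≤ n) : qInt q m ≤ qInt q n :=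
  Finset.sum_le_sum_of_subset_of_nonneg (Finset.range_mono h) fun _ _ _ => by positivity

theorem qInt_succ_pos {q : ℝ} (hq : 0 < q) (n : ℕ) : 0 < qInt q (n + 1) := by
  rw [qInt_succ]
  have := qInt_nonneg hq n
  positivity

theorem qFactorial_succ (q : ℝ) (n : ℕ) :
    qFactorial q (n + 1) = qFactorial q n * qInt q (n + 1) := by
  simp only [qFactorial, Finset.prod_range_succ]

theorem qFactorial_pos {q : ℝ} (hq : 0 < q) (n : ℕ) : 0 < qFactorial q n :=
  Finset.prod_pos fun i _ => qInt_succ_pos hq i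

theorem qOnePlusPow_pos {q x : ℝ} (hq : 0 < q) (hx : 0 ≤ x) (m : ℕ) : 0 < qOnePlusPow q x m :=
  Finset.prod_pos fun i _ => by positivity

theorem qOnePlusPow_succ (q x : ℝ) (m : ℕ) :
    qOnePlusPow q x (m + 1) = qOnePlusPow q x m * (1 + q ^ m * x) := by
  simp only [qOnePlusPow, Finset.prod_range_succ]

/-- The `q⁻¹`-integer up to a factor `q`: `[n]_q q^(-n) = q⁻¹ + ⋯ + q^(-n)`. -/
noncomputable def qIntInv (q : ℝ) (n : ℕ) : ℝ := qInt q n / q ^ n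

theorem qIntInv_zero (q : ℝ) : qIntInv q 0 = 0 := by simp [qIntInv, qInt]

theorem qIntInv_succ {q : ℝ} (hq : 0 < q) (n : ℕ) :
    qIntInv q (n + 1) = (qIntInv q n + 1) / q := by
  rw [qIntInv, qIntInv, qInt_succ', pow_succ]
  field_simp

theorem one_sub_mul_qIntInv {q : ℝ} (hq : 0 < q) (n : ℕ) :
    (1 - q) * qIntInv q n = (q ^ n)⁻¹ - 1 := by
  induction n with
  | zero => simp [qIntInv_zero]
  | succ n ih =>
    rw [qIntInv_succ hq, mul_div_assoc', mul_add, ih, pow_succ]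
    field_simp
    ring

/-- The product `∏_{i=1}^n [i]_q q^(-i)`. -/
noncomputable def qFactorialInv (q : ℝ) (n : ℕ) : ℝ := ∏ i ∈ Finset.range n, qIntInv q (i + 1)

theorem qFactorialInv_succ (q : ℝ) (n : ℕ) :
    qFactorialInv q (n + 1) = qFactorialInv q n * qIntInv q (n + 1) := by
  simp only [qFactorialInv, Finset.prod_range_succ]

theorem choose_two_succ (k : ℕ) : (k + 1).choose 2 = k.choose 2 + k := by
  rw [Nat.choose_succ_succ' k 1, Nat.choose_one_right, add_comm]

theorem qFactorialInv_eq (q : ℝ) (n : ℕ) :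
    qFactorialInv q n = qFactorial q n / q ^ ((n + 1).choose 2) := by
  induction n with
  | zero => simp [qFactorialInv, qFactorial]
  | succ n ih =>
    rw [qFactorialInv_succ, ih, qFactorial_succ, choose_two_succ (n + 1), qIntInv,
      pow_add q ((n + 1).choose 2), div_mul_div_comm]

/-! ### The `q`-exponential and its Jackson moments -/

theorem summable_qExp_exponents {q : ℝ} (hq : 0 < q) (hq1 : q < 1) (u : ℝ) :
    Summable fun j : ℕ => (1 - q) * q ^ j * u :=
  ((summable_geometric_of_lt_one hq.le hq1).mul_left (1 - q)).mul_right u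

theorem multipliable_qExp {q : ℝ} (hq : 0 < q) (hq1 : q < 1) (u : ℝ) :
    Multipliable fun j : ℕ => (1 + (1 - q) * q ^ j * u) :=
  Real.multipliable_one_add_of_summable (summable_qExp_exponents hq hq1 u)

theorem qExp_neg (q u : ℝ) : qExp q (-u) = (∏' j : ℕ, (1 + (1 - q) * q ^ j * u))⁻¹ := by
  simp [qExp]

theorem one_le_qExp_prod {q : ℝ} (hq : 0 < q) (hq1 : q < 1) {u : ℝ} (hu : 0 ≤ u) :
    1 ≤ ∏' j : ℕ, (1 + (1 - q) * q ^ j * u) := by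
  have h1 : 0 < 1 - q := by linarith
  refine ge_of_tendsto' (multipliable_qExp hq hq1 u).hasProd.tendsto_prod_nat fun n => ?_
  refine Finset.one_le_prod fun j _ => ?_
  have : 0 ≤ (1 - q) * q ^ j * u := by positivity
  linarith

/-- The exponents `(1 - q) q^j u` sum to `u`, and `1 + v ≤ exp v`. This later gives `e_q^{-u} → 1`
as `u → 0` by squeezing. -/
theorem qExp_prod_le_exp {q : ℝ} (hq : 0 < q) (hq1 : q < 1) {u : ℝ} (hu : 0 ≤ u) :
    ∏' j : ℕ, (1 + (1 - q) * q ^ j * u) ≤ Real.exp u := by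
  have h1 : 0 < 1 - q := by linarith
  have hs : ∑' j : ℕ, (1 - q) * q ^ j * u = u := by
    rw [tsum_mul_right, tsum_mul_left, tsum_geometric_of_lt_one hq.le hq1,
      mul_inv_cancel₀ h1.ne', one_mul]
  refine le_of_tendsto' (multipliable_qExp hq hq1 u).hasProd.tendsto_prod_nat fun n => ?_
  calc ∏ j ∈ Finset.range n, (1 + (1 - q) * q ^ j * u)
      ≤ ∏ j ∈ Finset.range n, Real.exp ((1 - q) * q ^ j * u) :=
        Finset.prod_le_prod (fun j _ => by positivity) fun j _ => by
          linarith [Real.add_one_le_exp ((1 - q) * q ^ j * u)]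
    _ = Real.exp (∑ j ∈ Finset.range n, (1 - q) * q ^ j * u) := (Real.exp_sum _ _).symm
    _ ≤ Real.exp u := by
        refine Real.exp_le_exp.2 ?_
        conv_rhs => rw [← hs]
        exact (summable_qExp_exponents hq hq1 u).sum_le_tsum _ fun j _ => by positivity

theorem qExp_neg_pos {q : ℝ} (hq : 0 < q) (hq1 : q < 1) {u : ℝ} (hu : 0 ≤ u) :
    0 < qExp q (-u) := by
  rw [qExp_neg]
  exact inv_pos.2 (by linarith [one_le_qExp_prod hq hq1 hu])

theorem qExp_neg_le_one {q : ℝ} (hq : 0 < q) (hq1 : q < 1) {u : ℝ} (hu : 0 ≤ u) :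
    qExp q (-u) ≤ 1 := by
  rw [qExp_neg]
  exact inv_le_one_of_one_le₀ (one_le_qExp_prod hq hq1 hu)

theorem exp_neg_le_qExp_neg {q : ℝ} (hq : 0 < q) (hq1 : q < 1) {u : ℝ} (hu : 0 ≤ u) :
    Real.exp (-u) ≤ qExp q (-u) := by
  rw [qExp_neg, Real.exp_neg]
  exact inv_anti₀ (by linarith [one_le_qExp_prod hq hq1 hu]) (qExp_prod_le_exp hq hq1 hu)

/-- Splitting off the factor `j = 0` of the product gives this `q`-difference equation, from which
all the Jackson moments follow. -/
theorem qExp_neg_mul {q : ℝ} (hq : 0 < q) (hq1 : q < 1) {u : ℝ} (hu : 0 ≤ u) :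
    qExp q (-(q * u)) = (1 + (1 - q) * u) * qExp q (-u) := by
  have h1 : 0 < 1 - q := by linarith
  have hne : (1 + (1 - q) * u) ≠ 0 := by positivity
  have hsplit : ∏' j : ℕ, (1 + (1 - q) * q ^ j * u) =
      (1 + (1 - q) * u) * ∏' j : ℕ, (1 + (1 - q) * q ^ j * (q * u)) := by
    have hm : Multipliable fun j : ℕ => (1 + (1 - q) * q ^ (j + 1) * u) :=
      (multipliable_qExp hq hq1 (q * u)).congr fun j => by ring
    have h2 := hm.hasProd.zero_mul (f := fun j : ℕ => (1 + (1 - q) * q ^ j * u))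
    rw [h2.tprod_eq]
    simp only [pow_zero, mul_one]
    congr 1
    exact tprod_congr fun j => by ring
  rw [qExp_neg, qExp_neg, hsplit, mul_inv, mul_inv_cancel_left₀ hne]

theorem hasSum_int_telescope {F : ℤ → ℝ} (hF : Monotone F) {a b : ℝ}
    (ha : Tendsto (fun n : ℕ => F (-(n : ℤ))) atTop (𝓝 a))
    (hb : Tendsto (fun n : ℕ => F n) atTop (𝓝 b)) :
    HasSum (fun j : ℤ => F (j + 1) - F j) (b - a) := by
  have hnn : ∀ j : ℤ, 0 ≤ F (j + 1) - F j := fun j => sub_nonneg.2 (hF (by lia))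
  have h1 : HasSum (fun n : ℕ => F ((n : ℤ) + 1) - F n) (b - F 0) := by
    rw [hasSum_iff_tendsto_nat_of_nonneg fun n => hnn n]
    have : ∀ n : ℕ, ∑ i ∈ Finset.range n, (F ((i : ℤ) + 1) - F i) = F n - F 0 := fun n => by
      have := Finset.sum_range_sub (fun i : ℕ => F i) n
      push_cast at this
      exact this
    simp only [this]
    exact hb.sub_const _
  have h2 : HasSum (fun n : ℕ => F (-((n : ℤ) + 1) + 1) - F (-((n : ℤ) + 1))) (F 0 - a) := by
    rw [hasSum_iff_tendsto_nat_of_nonneg fun n => hnn _]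
    have : ∀ n : ℕ, ∑ i ∈ Finset.range n, (F (-((i : ℤ) + 1) + 1) - F (-((i : ℤ) + 1))) =
        F 0 - F (-(n : ℤ)) := fun n => by
      have := Finset.sum_range_sub' (fun i : ℕ => F (-(i : ℤ))) n
      push_cast at this
      rw [neg_zero] at this
      rw [← this]
      refine Finset.sum_congr rfl fun i _ => ?_
      congr 2
      ring
    simp only [this]
    exact ha.const_sub _
  have := HasSum.of_nat_of_neg_add_one (f := fun j : ℤ => F (j + 1) - F j) h1 h2
  rwa [sub_add_sub_cancel] at this

/-- By the `q`-difference equation, `(1 - q) u e_q^{-u}` is the increment of `e_q^{-u}` from `u` to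
`q u`, so the bilateral sum telescopes to `1 - 0`. -/
theorem hasSum_qExp_moment_one {q : ℝ} (hq : 0 < q) (hq1 : q < 1) {c : ℝ} (hc : 0 < c) :
    HasSum (fun j : ℤ => (q ^ j * c) * qExp q (-(q ^ j * c))) (1 - q)⁻¹ := by
  have h1 : 0 < 1 - q := by linarith
  set F : ℤ → ℝ := fun j => qExp q (-(q ^ j * c)) with hF
  have hstep : ∀ j : ℤ, F (j + 1) - F j = (1 - q) * ((q ^ j * c) * qExp q (-(q ^ j * c))) := by
    intro j
    have : q ^ (j + 1) * c = q * (q ^ j * c) := by rw [zpow_add_one₀ hq.ne']; ring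
    simp only [hF]
    rw [this, qExp_neg_mul hq hq1 (by positivity)]
    ring
  have hmono : Monotone F := monotone_int_of_le_succ fun j => by
    have := qExp_neg_pos hq hq1 (u := q ^ j * c) (by positivity)
    have h2 := hstep j
    have : 0 ≤ (1 - q) * ((q ^ j * c) * qExp q (-(q ^ j * c))) := by positivity
    linarith
  have hpow : Tendsto (fun n : ℕ => q ^ (n : ℤ) * c) atTop (𝓝 0) := by
    simpa using (tendsto_pow_atTop_nhds_zero_of_lt_one hq.le hq1).mul_const c
  have hb : Tendsto (fun n : ℕ => F n) atTop (𝓝 1) := by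
    have hlow : Tendsto (fun n : ℕ => Real.exp (-(q ^ (n : ℤ) * c))) atTop (𝓝 1) := by
      have := (Real.continuous_exp.tendsto _).comp hpow.neg
      simpa [Function.comp_def] using this
    exact tendsto_of_tendsto_of_tendsto_of_le_of_le hlow tendsto_const_nhds
      (fun n => exp_neg_le_qExp_neg hq hq1 (by positivity))
      (fun n => qExp_neg_le_one hq hq1 (by positivity))
  -- Decay at infinity: `(1 + (1 - q) u) e_q^{-u} = e_q^{-qu} ≤ 1` bounds `e_q^{-u}` by `1 / ((1 -
  -- q) u)`.
  have ha : Tendsto (fun n : ℕ => F (-(n : ℤ))) atTop (𝓝 0) := by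
    have hup : Tendsto (fun n : ℕ => ((1 - q) * c)⁻¹ * q ^ n) atTop (𝓝 0) := by
      simpa using (tendsto_pow_atTop_nhds_zero_of_lt_one hq.le hq1).const_mul ((1 - q) * c)⁻¹
    refine tendsto_of_tendsto_of_tendsto_of_le_of_le tendsto_const_nhds hup
      (fun n => (qExp_neg_pos hq hq1 (by positivity)).le) fun n => ?_
    have hu : 0 < q ^ (-(n : ℤ)) * c := by positivity
    have h2 := qExp_neg_mul hq hq1 hu.le
    have h3 := qExp_neg_le_one hq hq1 (u := q * (q ^ (-(n : ℤ)) * c)) (by positivity)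
    have h4 := qExp_neg_pos hq hq1 hu.le
    rw [h2] at h3
    have h5 : F (-(n : ℤ)) * ((1 - q) * (q ^ (-(n : ℤ)) * c)) ≤ 1 := by
      simp only [hF]; linarith
    rw [zpow_neg, zpow_natCast] at h5
    have h6 : ((1 - q) * c)⁻¹ * q ^ n = 1 / ((1 - q) * ((q ^ n)⁻¹ * c)) := by field_simp
    simp only [h6]
    rw [le_div_iff₀ (by positivity)]
    exact h5
  have := (hasSum_int_telescope hmono ha hb).mul_left (1 - q)⁻¹
  refine hasSum_of_eq this (fun j => ?_) (by ring)
  rw [hstep, inv_mul_cancel_left₀ h1.ne']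

/-- Write `S_k` for the sum. Shifting `j` by one leaves it unchanged but replaces `u` by `q u`, so
`S_k = q^(k+1) (S_k + (1 - q) S_{k+1})`, which determines `S_{k+1}`. -/
theorem hasSum_qExp_moment {q : ℝ} (hq : 0 < q) (hq1 : q < 1) {c : ℝ} (hc : 0 < c) (k : ℕ) :
    HasSum (fun j : ℤ => (q ^ j * c) ^ (k + 1) * qExp q (-(q ^ j * c)))
      (qFactorialInv q k / (1 - q)) := by
  have h1 : 0 < 1 - q := by linarith
  induction k with
  | zero => simpa [qFactorialInv] using hasSum_qExp_moment_one hq hq1 hc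
  | succ k ih =>
    have hshift : HasSum (fun j : ℤ => (q ^ (j + 1) * c) ^ (k + 1) * qExp q (-(q ^ (j + 1) * c)))
        (qFactorialInv q k / (1 - q)) := (Equiv.addRight (1 : ℤ)).hasSum_iff.2 ih
    have h2 := ((hshift.mul_left (q ^ (k + 1))⁻¹).sub ih).mul_left (1 - q)⁻¹
    have hval : (1 - q)⁻¹ * ((q ^ (k + 1))⁻¹ * (qFactorialInv q k / (1 - q)) -
        qFactorialInv q k / (1 - q)) = qFactorialInv q (k + 1) / (1 - q) := by
      rw [qFactorialInv_succ, ← sub_one_mul, ← one_sub_mul_qIntInv hq (k + 1)]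
      field_simp
    refine hasSum_of_eq h2 (fun j => ?_) hval.symm
    have : q ^ (j + 1) * c = q * (q ^ j * c) := by rw [zpow_add_one₀ hq.ne']; ring
    rw [this, qExp_neg_mul hq hq1 (by positivity), mul_pow q]
    generalize q ^ j * c = u
    field_simp
    ring

/-! ### The `q`-Baskakov weights -/

/-- The weights `[N+k choose k]_q q^(k(k-1)/2) x^k / (1 + x)_q^(N+1+k)` of the `q`-Baskakov
operator of degree `N + 1`. -/
noncomputable def baskakovWeight (q : ℝ) (N : ℕ) (x : ℝ) (k : ℕ) : ℝ :=
  qFactorial q (N + k) / (qFactorial q k * qFactorial q N) * q ^ (k.choose 2) *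
    (x ^ k / qOnePlusPow q x (N + 1 + k))

theorem baskakovWeight_nonneg {q x : ℝ} (hq : 0 < q) (hx : 0 ≤ x) (N k : ℕ) :
    0 ≤ baskakovWeight q N x k := by
  have := qFactorial_pos hq (N + k)
  have := qFactorial_pos hq k
  have := qFactorial_pos hq N
  have := qOnePlusPow_pos hq hx (N + 1 + k)
  unfold baskakovWeight
  positivity

theorem baskakovWeight_zero_step {q x : ℝ} (hq : 0 < q) (hx : 0 ≤ x) (k : ℕ) :
    baskakovWeight q 0 x (k + 1) =
      q ^ k * x * baskakovWeight q 0 x k - q ^ (k + 1) * x * baskakovWeight q 0 x (k + 1) := by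
  have h1 := (qFactorial_pos hq (k + 1)).ne'
  have h2 := (qFactorial_pos hq k).ne'
  have h4 := (qOnePlusPow_pos hq hx (0 + 1 + k)).ne'
  have h5 : (1 + q ^ (0 + 1 + k) * x) ≠ 0 := by positivity
  have h6 := qOnePlusPow_succ q x (0 + 1 + k)
  have h7 : qFactorial q 0 = 1 := by simp [qFactorial]
  simp only [baskakovWeight, ← add_assoc, h6, choose_two_succ, h7, pow_add q (k.choose 2) k]
  rw [zero_add k]
  field_simp
  ring

/-- A `q`-Pascal rule, from `[N+k+2] = [N+1] + q^(N+1) [k+1]`, arranged so that the last two terms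
telescope in `k`. -/
theorem baskakovWeight_succ_step {q x : ℝ} (hq : 0 < q) (hx : 0 ≤ x) (N k : ℕ) :
    baskakovWeight q (N + 1) x (k + 1) = baskakovWeight q N x (k + 1) +
      q ^ (N + 1 + k) * x * baskakovWeight q (N + 1) x k -
      q ^ (N + 1 + (k + 1)) * x * baskakovWeight q (N + 1) x (k + 1) := by
  have h1 := (qFactorial_pos hq (N + 1 + k)).ne'
  have h2 := (qFactorial_pos hq k).ne'
  have h3 := (qFactorial_pos hq N).ne'
  have h4 := (qOnePlusPow_pos hq hx (N + 1 + k + 1)).ne'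
  have h5 : (1 + q ^ (N + 1 + k + 1) * x) ≠ 0 := by positivity
  have h6 := qOnePlusPow_succ q x (N + 1 + k + 1)
  have h7 := (qInt_succ_pos hq k).ne'
  have h8 := (qInt_succ_pos hq N).ne'
  have h9 : qInt q (N + 1 + k + 1) = qInt q (N + 1) + q ^ (N + 1) * qInt q (k + 1) := by
    rw [add_assoc, qInt_add]
  have e1 : N + (k + 1) = N + 1 + k := by lia
  have e2 : N + 1 + 1 + k = N + 1 + k + 1 := by lia
  simp only [baskakovWeight, ← add_assoc, e1, e2, h6, choose_two_succ, pow_add q (k.choose 2) k,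
    qFactorial_succ q k, qFactorial_succ q N, qFactorial_succ q (N + 1 + k), h9]
  field_simp
  ring

theorem baskakovWeight_zero_zero {q x : ℝ} (hx : 0 ≤ x) :
    baskakovWeight q 0 x 0 = 1 - x * baskakovWeight q 0 x 0 := by
  have : 1 + x ≠ 0 := by positivity
  simp [baskakovWeight, qFactorial, qOnePlusPow]
  field_simp
  ring

theorem baskakovWeight_succ_zero {q x : ℝ} (hq : 0 < q) (hx : 0 ≤ x) (N : ℕ) :
    baskakovWeight q (N + 1) x 0 =
      baskakovWeight q N x 0 - q ^ (N + 1) * x * baskakovWeight q (N + 1) x 0 := by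
  have h1 := (qFactorial_pos hq N).ne'
  have h2 := (qFactorial_pos hq (N + 1)).ne'
  have h3 : qFactorial q 0 = 1 := by simp [qFactorial]
  have h4 := (qOnePlusPow_pos hq hx (N + 1)).ne'
  have h5 : (1 + q ^ (N + 1) * x) ≠ 0 := by positivity
  simp only [baskakovWeight, add_zero, h3, qOnePlusPow_succ q x (N + 1), Nat.choose_zero_succ,
    pow_zero]
  field_simp
  ring

theorem sum_baskakovWeight_zero {q x : ℝ} (hq : 0 < q) (hx : 0 ≤ x) (m : ℕ) :
    ∑ k ∈ Finset.range (m + 1), baskakovWeight q 0 x k =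
      1 - q ^ m * x * baskakovWeight q 0 x m := by
  induction m with
  | zero => simpa using baskakovWeight_zero_zero hx
  | succ m ih =>
    rw [Finset.sum_range_succ, ih]
    linarith [baskakovWeight_zero_step hq hx m]

theorem sum_baskakovWeight_succ {q x : ℝ} (hq : 0 < q) (hx : 0 ≤ x) (N m : ℕ) :
    ∑ k ∈ Finset.range (m + 1), baskakovWeight q (N + 1) x k =
      ∑ k ∈ Finset.range (m + 1), baskakovWeight q N x k -
        q ^ (N + 1 + m) * x * baskakovWeight q (N + 1) x m := by
  induction m with
  | zero => simpa using baskakovWeight_succ_zero hq hx N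
  | succ m ih =>
    rw [Finset.sum_range_succ, ih, Finset.sum_range_succ _ (m + 1)]
    linarith [baskakovWeight_succ_step hq hx N m]

theorem sum_baskakovWeight_le_one {q x : ℝ} (hq : 0 < q) (hx : 0 ≤ x) (N m : ℕ) :
    ∑ k ∈ Finset.range (m + 1), baskakovWeight q N x k ≤ 1 := by
  induction N with
  | zero =>
    have := baskakovWeight_nonneg hq hx 0 m
    have : 0 ≤ q ^ m * x * baskakovWeight q 0 x m := by positivity
    linarith [sum_baskakovWeight_zero hq hx m]
  | succ N ih =>
    have := baskakovWeight_nonneg hq hx (N + 1) m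
    have : 0 ≤ q ^ (N + 1 + m) * x * baskakovWeight q (N + 1) x m := by positivity
    linarith [sum_baskakovWeight_succ hq hx N m]

theorem baskakovWeight_le_one {q x : ℝ} (hq : 0 < q) (hx : 0 ≤ x) (N m : ℕ) :
    baskakovWeight q N x m ≤ 1 :=
  (Finset.single_le_sum (fun k _ => baskakovWeight_nonneg hq hx N k)
    (Finset.self_mem_range_succ m)).trans (sum_baskakovWeight_le_one hq hx N m)

theorem tendsto_baskakovWeight_remainder {q x : ℝ} (hq : 0 < q) (hq1 : q < 1) (hx : 0 ≤ x)
    (N j : ℕ) : Tendsto (fun m : ℕ => q ^ (j + m) * x * baskakovWeight q N x m) atTop (𝓝 0) := by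
  have hup : Tendsto (fun m : ℕ => q ^ j * x * q ^ m) atTop (𝓝 0) := by
    simpa using (tendsto_pow_atTop_nhds_zero_of_lt_one hq.le hq1).const_mul (q ^ j * x)
  refine tendsto_of_tendsto_of_tendsto_of_le_of_le tendsto_const_nhds hup (fun m => ?_)
    fun m => ?_
  · have := baskakovWeight_nonneg hq hx N m
    positivity
  · have h := mul_le_mul_of_nonneg_left (baskakovWeight_le_one hq hx N m)
      (by positivity : 0 ≤ q ^ (j + m) * x)
    calc _ ≤ q ^ (j + m) * x * 1 := h
      _ = _ := by rw [pow_add]; ring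

/-- Raising `N` changes a partial sum only by a boundary term, which tends to `0` because the
weights are at most `1` and carry a factor `q^m`. -/
theorem hasSum_baskakovWeight {q x : ℝ} (hq : 0 < q) (hq1 : q < 1) (hx : 0 ≤ x) (N : ℕ) :
    HasSum (baskakovWeight q N x) 1 := by
  rw [hasSum_iff_tendsto_nat_of_nonneg (baskakovWeight_nonneg hq hx N),
    ← tendsto_add_atTop_iff_nat 1]
  induction N with
  | zero =>
    simp only [sum_baskakovWeight_zero hq hx]
    simpa using (tendsto_baskakovWeight_remainder hq hq1 hx 0 0).const_sub 1
  | succ N ih =>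
    simp only [sum_baskakovWeight_succ hq hx]
    simpa using ih.sub (tendsto_baskakovWeight_remainder hq hq1 hx (N + 1) (N + 1))

/-- The `q`-analogue of `k * choose (N+k) k = (N+1) * choose (N+k) (k-1)`: each factor `qIntInv` is
absorbed by raising `N`, which reduces moments to total mass. -/
theorem baskakovWeight_mul_qIntInv {q x : ℝ} (hq : 0 < q) (hx : 0 ≤ x) (N k : ℕ) :
    baskakovWeight q N x (k + 1) * qIntInv q (k + 1) =
      qInt q (N + 1) * x / q * baskakovWeight q (N + 1) x k := by
  have h1 := (qFactorial_pos hq (N + 1 + k)).ne'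
  have h2 := (qFactorial_pos hq k).ne'
  have h3 := (qFactorial_pos hq N).ne'
  have h4 := (qOnePlusPow_pos hq hx (N + 1 + k + 1)).ne'
  have h7 := (qInt_succ_pos hq k).ne'
  have h8 := (qInt_succ_pos hq N).ne'
  have e1 : N + (k + 1) = N + 1 + k := by lia
  have e2 : N + 1 + 1 + k = N + 1 + k + 1 := by lia
  simp only [baskakovWeight, qIntInv, e1, e2, ← add_assoc, choose_two_succ,
    pow_add q (k.choose 2) k, qFactorial_succ q k, qFactorial_succ q N]
  field_simp
  ring

theorem hasSum_baskakovWeight_mul {q x : ℝ} (hq : 0 < q) (hx : 0 ≤ x) (N : ℕ) {g : ℕ → ℝ} {s : ℝ}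
    (h : HasSum (fun k => baskakovWeight q (N + 1) x k * g k) s) :
    HasSum (fun k => baskakovWeight q N x k * (qIntInv q k * g (k - 1)))
      (qInt q (N + 1) * x / q * s) := by
  -- The term `k = 0` vanishes since `qIntInv q 0 = 0`, so the truncated `k - 1` is harmless.
  rw [← hasSum_nat_add_iff' 1]
  refine hasSum_of_eq (h.mul_left (qInt q (N + 1) * x / q)) (fun k => ?_) ?_
  · rw [← mul_assoc, baskakovWeight_mul_qIntInv hq hx, Nat.add_sub_cancel, mul_assoc]
  · simp [qIntInv_zero]

theorem hasSum_baskakovWeight_first {q x : ℝ} (hq : 0 < q) (hq1 : q < 1) (hx : 0 ≤ x) (N : ℕ) :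
    HasSum (fun k => baskakovWeight q N x k * qIntInv q k) (qInt q (N + 1) * x / q) := by
  have h := hasSum_baskakovWeight_mul (g := fun _ => 1) hq hx N
    (by simpa using hasSum_baskakovWeight hq hq1 hx (N + 1))
  simpa using h

/-- A second factorial moment: `q * qIntInv q k - 1` is `qIntInv q (k - 1)` for `k ≥ 1`. -/
theorem hasSum_baskakovWeight_second {q x : ℝ} (hq : 0 < q) (hq1 : q < 1) (hx : 0 ≤ x) (N : ℕ) :
    HasSum (fun k => baskakovWeight q N x k * (qIntInv q k * (q * qIntInv q k - 1)))
      (qInt q (N + 1) * x / q * (qInt q (N + 2) * x / q)) := by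
  have h := hasSum_baskakovWeight_mul (g := qIntInv q) hq hx N
    (hasSum_baskakovWeight_first hq hq1 hx (N + 1))
  refine hasSum_of_eq h (fun k => ?_) rfl
  cases k with
  | zero => simp [qIntInv_zero]
  | succ k =>
    rw [Nat.add_sub_cancel, qIntInv_succ hq k]
    field_simp
    ring

/-! ### Moments of the operator -/

theorem sq_eq_choose_add_choose (k : ℕ) : k ^ 2 = k.choose 2 + (k + 1).choose 2 := by
  induction k with
  | zero => rfl
  | succ k ih =>
    rw [choose_two_succ (k + 1), choose_two_succ k] at *
    linarith

theorem baskakovBasis_nonneg {q x : ℝ} (hq : 0 < q) (hx : 0 ≤ x) (n p k : ℕ) :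
    0 ≤ baskakovBasis q n p k x := by
  have := qFactorial_pos hq (n + p + k - 1)
  have := qFactorial_pos hq k
  have := qFactorial_pos hq (n + p + k - 1 - k)
  have := qOnePlusPow_pos hq hx (n + p + k)
  unfold baskakovBasis qBinom
  positivity

/-- Here `k^2` splits as `choose k 2 + choose (k+1) 2`; the zeroth Szász moment cancels the second
part. -/
theorem baskakovBasis_mul {q : ℝ} (hq : 0 < q) {n p N : ℕ} (h : n + p = N + 1) (k : ℕ) (x : ℝ) :
    baskakovBasis q n p k x * (qFactorialInv q k / qFactorial q k) = baskakovWeight q N x k := by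
  have h1 : n + p + k - 1 = N + k := by lia
  have h2 : N + k - k = N := by lia
  have h3 := (qFactorial_pos hq k).ne'
  rw [baskakovBasis, baskakovWeight, qBinom, h1, h2, h, sq_eq_choose_add_choose, pow_add,
    qFactorialInv_eq]
  field_simp

theorem szaszBasis_nonneg {q t : ℝ} (hq : 0 < q) (hq1 : q < 1) (ht : 0 ≤ t) (n p k : ℕ) :
    0 ≤ szaszBasis q n p k t := by
  have h1 := qInt_nonneg hq (n + p)
  have h2 := qFactorial_pos hq k
  have h3 := qExp_neg_pos hq hq1 (mul_nonneg h1 ht)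
  unfold szaszBasis
  positivity

theorem hasSum_jacksonTerm_pow {A q : ℝ} (hA : 0 < A) (hq : 0 < q) (hq1 : q < 1) {n p N : ℕ}
    (h : n + p = N + 1) (k m : ℕ) :
    HasSum (jacksonTerm q (A * (1 - q)) (fun t => t ^ m * szaszBasis q n p k t))
      ((qInt q (n + p) ^ (m + 1) * qFactorial q k)⁻¹ * (qFactorialInv q (k + m) / (1 - q))) := by
  have h1 : 0 < 1 - q := by linarith
  have hQ : 0 < qInt q (n + p) := h ▸ qInt_succ_pos hq N
  have hF := qFactorial_pos hq k
  have hc : 0 < qInt q (n + p) / (A * (1 - q)) := by positivity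
  refine hasSum_of_eq ((hasSum_qExp_moment hq hq1 hc (k + m)).mul_left
    (qInt q (n + p) ^ (m + 1) * qFactorial q k)⁻¹) (fun j => ?_) rfl
  have e : q ^ j * (qInt q (n + p) / (A * (1 - q))) = qInt q (n + p) * (q ^ j / (A * (1 - q))) := by
    ring
  rw [e, jacksonTerm, szaszBasis]
  generalize q ^ j / (A * (1 - q)) = t
  field_simp
  ring

theorem hasSum_jacksonTerm_quadratic {A q : ℝ} (hA : 0 < A) (hq : 0 < q) (hq1 : q < 1) {n p N : ℕ}
    (h : n + p = N + 1) (k : ℕ) (a b x : ℝ) :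
    HasSum (jacksonTerm q (A * (1 - q)) (fun t => (a + b * (t - x) ^ 2) * szaszBasis q n p k t))
      ((qInt q (n + p) * (1 - q))⁻¹ * (qFactorialInv q k / qFactorial q k) *
        (a + b * (qIntInv q (k + 1) * qIntInv q (k + 2) / qInt q (n + p) ^ 2 -
          2 * x * (qIntInv q (k + 1) / qInt q (n + p)) + x ^ 2))) := by
  have h1 : 0 < 1 - q := by linarith
  have hQ : 0 < qInt q (n + p) := h ▸ qInt_succ_pos hq N
  have hF := qFactorial_pos hq k
  have H := fun m => hasSum_jacksonTerm_pow hA hq hq1 h k m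
  refine hasSum_of_eq ((((H 0).mul_left (a + b * x ^ 2)).add ((H 1).mul_left (-(2 * b * x)))).add
    ((H 2).mul_left b)) (fun j => ?_) ?_
  · simp only [jacksonTerm]
    ring
  · rw [add_zero, qFactorialInv_succ q (k + 1), qFactorialInv_succ q k]
    field_simp
    ring

/-- The second central moment of the operator, as a function of `q`, `s = 1 / [n+p]_q` and `x`. -/
noncomputable def centralMoment (q s x : ℝ) : ℝ :=
  ((s + q) * x ^ 2 / q ^ 3 + (2 + q + 1 / q) * s * x / q + (1 + q) * s ^ 2) / q ^ 3 -
    2 * x * ((x / q + s) / q) + x ^ 2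

theorem hasSum_baskakovWeight_quadratic {q x : ℝ} (hq : 0 < q) (hq1 : q < 1) (hx : 0 ≤ x) (N : ℕ)
    (a b : ℝ) :
    HasSum (fun k => baskakovWeight q N x k *
        (a + b * (qIntInv q (k + 1) * qIntInv q (k + 2) / qInt q (N + 1) ^ 2 -
          2 * x * (qIntInv q (k + 1) / qInt q (N + 1)) + x ^ 2)))
      (a + b * centralMoment q (1 / qInt q (N + 1)) x) := by
  have hQ : 0 < qInt q (N + 1) := qInt_succ_pos hq N
  have h0 := hasSum_baskakovWeight hq hq1 hx N
  have h1 := hasSum_baskakovWeight_first hq hq1 hx N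
  have h2 := hasSum_baskakovWeight_second hq hq1 hx N
  rw [qInt_succ q (N + 1)] at h2
  generalize qInt q (N + 1) = Q at *
  -- With `Y = qIntInv q k`, the product `qIntInv q (k+1) * qIntInv q (k+2)` is `(Y + 1)(Y + 1 + q)
  -- / q^3`; the coefficients expand it in `Y (q Y - 1)`, `Y` and `1`.
  refine hasSum_of_eq (((h2.mul_left (b / (q ^ 4 * Q ^ 2))).add
    (h1.mul_left (b * ((2 + q + 1 / q) / (q ^ 3 * Q ^ 2) - 2 * x / (q * Q))))).add
    (h0.mul_left (a + b * ((1 + q) / (q ^ 3 * Q ^ 2) - 2 * x / (q * Q) + x ^ 2))))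
    (fun k => ?_) ?_
  · rw [qIntInv_succ hq (k + 1), qIntInv_succ hq k]
    generalize qIntInv q k = Y
    field_simp
    ring
  · unfold centralMoment
    field_simp
    ring

/-- Domination of `F - c E` by `G` yields convergence and the error bound together; it serves both
the Jackson sum and the sum over `k`. -/
theorem summable_and_abs_tsum_sub_le {ι : Type*} {F E G : ι → ℝ} {e g c : ℝ} (hE : HasSum E e)
    (hG : HasSum G g) (h : ∀ i, |F i - c * E i| ≤ G i) :
    Summable F ∧ |∑' i, F i - c * e| ≤ g := by
  have hD : Summable fun i => F i - c * E i := Summable.of_norm_bounded hG.summable h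
  have hF : Summable F := (hD.add (hE.summable.mul_left c)).congr fun i => by ring
  refine ⟨hF, ?_⟩
  have h2 := hF.hasSum.sub (hE.mul_left c)
  rw [← h2.tsum_eq]
  exact tsum_of_norm_bounded (f := fun i => F i - c * E i) hG h

theorem qBSS_converges_and_abs_sub_le {A q : ℝ} (hA : 0 < A) (hq : 0 < q) (hq1 : q < 1) {n p : ℕ}
    (hn : 1 ≤ n) {x : ℝ} (hx : 0 ≤ x) {f : ℝ → ℝ} {a b c : ℝ}
    (hf : ∀ t, 0 ≤ t → |f t - c| ≤ a + b * (t - x) ^ 2) :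
    QBSSConverges A q n p f x ∧
      |qBSS A q n p f x - c| ≤ a + b * centralMoment q (1 / qInt q (n + p)) x := by
  obtain ⟨N, h⟩ : ∃ N, n + p = N + 1 := ⟨n + p - 1, by lia⟩
  have h1 : 0 < 1 - q := by linarith
  have hQ : 0 < qInt q (n + p) := h ▸ qInt_succ_pos hq N
  -- Inner comparison: `E` integrates the constant `1` (coefficients `1, 0`), `G` the quadratic
  -- majorant.
  have hJ : ∀ k, Summable (jacksonTerm q (A * (1 - q)) (fun t => f t * szaszBasis q n p k t)) ∧ _ :=
    fun k => summable_and_abs_tsum_sub_le (c := c)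
      (hasSum_jacksonTerm_quadratic hA hq hq1 h k 1 0 x)
      (hasSum_jacksonTerm_quadratic hA hq hq1 h k a b x) fun j => by
        have ht : 0 ≤ q ^ j / (A * (1 - q)) := by positivity
        have hs := szaszBasis_nonneg hq hq1 ht n p k
        simp only [jacksonTerm]
        generalize q ^ j / (A * (1 - q)) = t at *
        have e : t * (f t * szaszBasis q n p k t) -
            c * (t * ((1 + 0 * (t - x) ^ 2) * szaszBasis q n p k t)) =
            (f t - c) * (t * szaszBasis q n p k t) := by ring
        rw [e, abs_mul, abs_of_nonneg (mul_nonneg ht hs)]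
        calc _ ≤ (a + b * (t - x) ^ 2) * (t * szaszBasis q n p k t) :=
              mul_le_mul_of_nonneg_right (hf t ht) (mul_nonneg ht hs)
          _ = _ := by ring
  have hK := summable_and_abs_tsum_sub_le (F := fun k => qInt q (n + p) * operatorTerm A q n p f x k)
    (c := c) (hasSum_baskakovWeight hq hq1 hx N)
    (hasSum_baskakovWeight_quadratic hq hq1 hx N a b) fun k => by
      have hB := baskakovBasis_nonneg hq hx n p k
      have hk := (hJ k).2
      have hC : 0 ≤ qInt q (n + p) * (1 - q) * baskakovBasis q n p k x := by positivity
      have hk2 := mul_le_mul_of_nonneg_left hk hC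
      rw [← abs_of_nonneg hC, ← abs_mul, abs_of_nonneg hC] at hk2
      rw [← baskakovBasis_mul hq h, operatorTerm, jacksonIntegral, ← h]
      refine (le_of_eq ?_).trans (hk2.trans (le_of_eq ?_))
      · congr 1
        field_simp
        ring
      · field_simp
  refine ⟨⟨fun k => (hJ k).1, ?_⟩, ?_⟩
  · exact (summable_mul_left_iff hQ.ne').1 hK.1
  · rw [tsum_mul_left, mul_one, ← h] at hK
    exact hK.2

/-! ### Statistical convergence -/

/-- As a quadratic in `x`, the moment has coefficients `c2`, `c1`, `c0` that are continuous in `(q,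
s)` at `(1, 0)` and vanish there. -/
theorem centralMoment_small (R : ℝ) {ε : ℝ} (hε : 0 < ε) :
    ∃ η : ℝ, 0 < η ∧ ∀ q s : ℝ, |q - 1| < η → |s| < η → ∀ x ∈ Set.Icc 0 R,
      centralMoment q s x ≤ ε := by
  set c2 : ℝ × ℝ → ℝ := fun z => (z.2 + z.1) / z.1 ^ 3 / z.1 ^ 3 - 2 / (z.1 * z.1) + 1 with hc2
  set c1 : ℝ × ℝ → ℝ := fun z =>
    (2 + z.1 + 1 / z.1) * z.2 / z.1 / z.1 ^ 3 - 2 * z.2 / z.1 with hc1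
  set c0 : ℝ × ℝ → ℝ := fun z => (1 + z.1) * z.2 ^ 2 / z.1 ^ 3 with hc0
  set D : ℝ × ℝ → ℝ := fun z => R ^ 2 * |c2 z| + R * |c1 z| + |c0 z| with hD
  have hcont : ContinuousAt D (1, 0) := by
    have h2 : ContinuousAt c2 (1, 0) := by
      simp only [hc2]; fun_prop (disch := norm_num)
    have h1 : ContinuousAt c1 (1, 0) := by
      simp only [hc1]; fun_prop (disch := norm_num)
    have h0 : ContinuousAt c0 (1, 0) := by
      simp only [hc0]; fun_prop (disch := norm_num)
    simp only [hD]
    fun_prop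
  have hzero : D (1, 0) = 0 := by
    simp only [hD, hc2, hc1, hc0]
    norm_num
  obtain ⟨η, hη, h⟩ := Metric.continuousAt_iff.1 hcont ε hε
  refine ⟨η, hη, fun q s hq hs x hx => ?_⟩
  have hdist : dist (q, s) ((1 : ℝ), (0 : ℝ)) < η := by
    rw [Prod.dist_eq, Real.dist_eq, Real.dist_eq, sub_zero]
    exact max_lt hq hs
  have hDlt := h hdist
  rw [hzero, Real.dist_eq, sub_zero] at hDlt
  have hx2 : x ^ 2 ≤ R ^ 2 := pow_le_pow_left₀ hx.1 hx.2 2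
  calc centralMoment q s x = x ^ 2 * c2 (q, s) + x * c1 (q, s) + c0 (q, s) := by
        simp only [centralMoment, hc2, hc1, hc0]
        ring
    _ ≤ R ^ 2 * |c2 (q, s)| + R * |c1 (q, s)| + |c0 (q, s)| := by
        have a2 := mul_le_mul_of_nonneg_right hx2 (abs_nonneg (c2 (q, s)))
        have a1 := mul_le_mul_of_nonneg_right hx.2 (abs_nonneg (c1 (q, s)))
        have b2 := mul_le_mul_of_nonneg_left (le_abs_self (c2 (q, s))) (sq_nonneg x)
        have b1 := mul_le_mul_of_nonneg_left (le_abs_self (c1 (q, s))) hx.1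
        linarith [le_abs_self (c0 (q, s))]
    _ ≤ ε := (le_abs_self _).trans hDlt.le

/-! ### Quadratic majorants and transfer to statistical limits. -/

/-- Heine–Cantor in the form where only `x` lies in the compact set: `t` may exceed `ν`. Composing
with `max t 0` turns one-sided continuity at `0` into continuity. -/
theorem MemC.uniform_on_Icc {ν : ℝ} {f : ℝ → ℝ} (hf : MemC ν f) {ε : ℝ} (hε : 0 < ε) :
    ∃ δ : ℝ, 0 < δ ∧ ∀ x ∈ Set.Icc 0 ν, ∀ t, 0 ≤ t → |t - x| < δ → |f t - f x| < ε := by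
  have hg : ∀ x ∈ Set.Icc (0 : ℝ) ν, ContinuousAt (fun t => f (max t 0)) x := by
    intro x hx
    have hm : Tendsto (fun t : ℝ => max t 0) (𝓝 x) (𝓝[Set.Ici 0] x) := by
      refine tendsto_nhdsWithin_iff.2 ⟨?_, .of_forall fun t => le_max_right t 0⟩
      have : ContinuousAt (fun t : ℝ => max t 0) x := by fun_prop
      simpa [ContinuousAt, max_eq_left hx.1] using this
    have := (hf.1 x hx).tendsto.comp hm
    simpa [ContinuousAt, max_eq_left hx.1, Function.comp_def] using this
  have h := isCompact_Icc.uniformContinuousAt_of_continuousAt _ hg (Metric.dist_mem_uniformity hε)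
  obtain ⟨δ, hδ, h⟩ := Metric.mem_uniformity_dist.1 h
  refine ⟨δ, hδ, fun x hx t ht htx => ?_⟩
  have := h (a := x) (b := t) (by rwa [dist_comm, Real.dist_eq]) hx
  simpa [max_eq_left hx.1, max_eq_left ht, dist_comm, Real.dist_eq, abs_sub_comm] using this

theorem MemC.exists_quadratic_bound {ν : ℝ} {f : ℝ → ℝ} (hf : MemC ν f) {ε : ℝ} (hε : 0 < ε) :
    ∃ b : ℝ, 0 < b ∧ ∀ x ∈ Set.Icc 0 ν, ∀ t, 0 ≤ t → |f t - f x| ≤ ε + b * (t - x) ^ 2 := by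
  obtain ⟨δ, hδ, h⟩ := hf.uniform_on_Icc hε
  obtain ⟨M, hM⟩ := hf.2
  have hM0 : 0 ≤ M := (abs_nonneg _).trans (hM 0 Set.self_mem_Ici)
  -- For `|t - x| ≥ δ` the quadratic term exceeds the trivial bound `2 M`; the `+ 1` keeps `b`
  -- positive when `M = 0`.
  refine ⟨(2 * M + 1) / δ ^ 2, by positivity, fun x hx t ht => ?_⟩
  rcases lt_or_ge |t - x| δ with hlt | hge
  · have : 0 ≤ (2 * M + 1) / δ ^ 2 * (t - x) ^ 2 := by positivity
    linarith [h x hx t ht hlt]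
  · have h1 : δ ^ 2 ≤ (t - x) ^ 2 := by
      rw [← sq_abs (t - x)]
      exact pow_le_pow_left₀ hδ.le hge 2
    have h2 : 2 * M + 1 ≤ (2 * M + 1) / δ ^ 2 * (t - x) ^ 2 := by
      rw [div_mul_eq_mul_div, le_div_iff₀ (by positivity)]
      exact mul_le_mul_of_nonneg_left h1 (by positivity)
    have h3 := abs_sub (f t) (f x)
    linarith [hM t ht, hM x hx.1]

/-- The bad indices of `z` lie in the union of those of `q` and `r`, and two sets of density zero
have a union of density zero. -/
theorem StatLim.of_two {q r z : ℕ → ℝ} {l m : ℝ} (hq : StatLim q l) (hr : StatLim r m)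
    (h : ∀ ε : ℝ, 0 < ε → ∃ η : ℝ, 0 < η ∧ ∀ n : ℕ, 1 ≤ n → |q n - l| < η → |r n - m| < η →
      |z n| < ε) : StatLim z 0 := by
  intro ε hε
  obtain ⟨η, hη, h⟩ := h ε hε
  have hsum := (hq η hη).add (hr η hη)
  rw [add_zero] at hsum
  refine tendsto_of_tendsto_of_tendsto_of_le_of_le tendsto_const_nhds hsum
    (fun n => by positivity) fun n => ?_
  rw [← add_div, ← Nat.cast_add]
  refine div_le_div_of_nonneg_right ?_ n.cast_nonneg
  have hfin : ∀ S : Set ℕ, (S ∩ Set.Icc 1 n).Finite := fun S =>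
    (Set.finite_Icc 1 n).subset Set.inter_subset_right
  have hsub : {j | ε ≤ |z j - 0|} ∩ Set.Icc 1 n ⊆
      ({j | η ≤ |q j - l|} ∩ Set.Icc 1 n) ∪ ({j | η ≤ |r j - m|} ∩ Set.Icc 1 n) := by
    rintro j ⟨hj, hj1⟩
    by_contra hcon
    simp only [Set.mem_union, Set.mem_inter_iff, Set.mem_ofPred_eq, hj1, and_true, not_or,
      not_le] at hcon
    have := h j hj1.1 hcon.1 hcon.2
    simp only [Set.mem_ofPred_eq, sub_zero] at hj
    linarith
  exact Nat.cast_le.2 <| (Set.ncard_le_ncard hsub ((hfin _).union (hfin _))).trans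
    (Set.ncard_union_le _ _)

theorem qBSS_uniform_approx {A : ℝ} (hA : 0 < A) (p : ℕ) {ν : ℝ} {f : ℝ → ℝ} (hf : MemC ν f)
    {ε : ℝ} (hε : 0 < ε) :
    ∃ η : ℝ, 0 < η ∧ ∀ (q : ℝ) (n : ℕ), 0 < q → q < 1 → 1 ≤ n → |q - 1| < η →
      |1 / qInt q n - 0| < η → ∀ x ∈ Set.Icc 0 ν, |qBSS A q n p f x - f x| ≤ ε := by
  obtain ⟨b, hb, hfb⟩ := hf.exists_quadratic_bound (half_pos hε)
  -- Multiplied by `b`, this tolerance contributes the remaining `ε / 2`.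
  obtain ⟨η, hη, h⟩ := centralMoment_small ν (ε := ε / (2 * b)) (by positivity)
  refine ⟨η, hη, fun q n hq hq1 hn hqη hsη x hx => ?_⟩
  have hpos : 0 < qInt q n := by
    obtain ⟨m, rfl⟩ : ∃ m, n = m + 1 := ⟨n - 1, by lia⟩
    exact qInt_succ_pos hq m
  have hle : qInt q n ≤ qInt q (n + p) := qInt_mono hq (Nat.le_add_right n p)
  have hs : |1 / qInt q (n + p)| < η := by
    rw [sub_zero, abs_of_pos (by positivity)] at hsη
    rw [abs_of_pos (one_div_pos.2 (hpos.trans_le hle))]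
    exact (one_div_le_one_div_of_le hpos hle).trans_lt hsη
  have h1 := (qBSS_converges_and_abs_sub_le (p := p) hA hq hq1 hn hx.1 (hfb x hx)).2
  have h2 := mul_le_mul_of_nonneg_left (h q _ hqη hs x hx) hb.le
  have h3 : b * (ε / (2 * b)) = ε / 2 := by field_simp
  linarith

theorem qBSS_bounded {A q : ℝ} (hA : 0 < A) (hq : 0 < q) (hq1 : q < 1) {n p : ℕ}
    (hn : 1 ≤ n) {f : ℝ → ℝ} {M : ℝ} (hM : ∀ t ∈ Set.Ici (0 : ℝ), |f t| ≤ M) {x : ℝ} (hx : 0 ≤ x) :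
    QBSSConverges A q n p f x ∧ |qBSS A q n p f x - f x| ≤ 2 * M := by
  obtain ⟨h1, h2⟩ := qBSS_converges_and_abs_sub_le (p := p) (a := M) (b := 0) (c := 0) hA hq hq1 hn
    hx (f := f) fun t ht => by simpa using hM t ht
  refine ⟨h1, (abs_sub _ _).trans ?_⟩
  rw [sub_zero, zero_mul, add_zero] at h2
  linarith [hM x hx]

/-! ### Estimates for the two norms. -/

theorem rhoNorm_nonneg (g : ℝ → ℝ) : 0 ≤ rhoNorm g :=
  Real.iSup_nonneg fun _ => by positivity

theorem supNorm_nonneg (ν : ℝ) (g : ℝ → ℝ) : 0 ≤ supNorm ν g :=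
  Real.iSup_nonneg fun _ => abs_nonneg _

/-- Beyond `R` the weight `1 + x^2 ≥ x ≥ R` alone makes the bounded `g` small. -/
theorem rhoNorm_le {g : ℝ → ℝ} {ε M R : ℝ} (hε : 0 ≤ ε) (hR : 0 < R) (hMR : M ≤ ε * R)
    (hM : ∀ x, 0 ≤ x → |g x| ≤ M) (h : ∀ x ∈ Set.Icc 0 R, |g x| ≤ ε) : rhoNorm g ≤ ε := by
  have : Nonempty (Set.Ici (0 : ℝ)) := ⟨⟨0, Set.self_mem_Ici⟩⟩
  refine ciSup_le fun ⟨x, hx⟩ => ?_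
  have hx : 0 ≤ x := hx
  rw [div_le_iff₀ (by positivity)]
  rcases le_total x R with hxR | hxR
  · nlinarith [h x ⟨hx, hxR⟩, mul_nonneg hε (sq_nonneg x)]
  · have h1 : R ≤ 1 + x ^ 2 := by nlinarith [sq_nonneg (x - 1)]
    exact ((hM x hx).trans hMR).trans (mul_le_mul_of_nonneg_left h1 hε)

theorem MemCB.memC {f : ℝ → ℝ} (hf : MemCB f) (ν : ℝ) : MemC ν f :=
  ⟨fun x hx => hf.1 x hx.1, hf.2⟩

end QBaskakov

theorem mainTheorem12 (A : ℝ) (hA : 0 < A) (p : ℕ) (q : ℕ → ℝ)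
    (hq : ∀ n : ℕ, 1 ≤ n → 0 < q n ∧ q n < 1)
    (a : ℝ) (ha : a < 1)
    (hq_one : QBaskakov.StatLim q 1)
    (hq_pow : QBaskakov.StatLim (fun n => q n ^ n) a)
    (hq_int : QBaskakov.StatLim (fun n => 1 / QBaskakov.qInt (q n) n) 0) :
    (∀ f : ℝ → ℝ, QBaskakov.MemCB f →
      (∀ n : ℕ, 1 ≤ n →
        (∀ x : ℝ, 0 ≤ x → QBaskakov.QBSSConverges A (q n) n p f x) ∧
        QBaskakov.MemBRho (fun x => QBaskakov.qBSS A (q n) n p f x - f x)) ∧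
      QBaskakov.StatLim
        (fun n => QBaskakov.rhoNorm (fun x => QBaskakov.qBSS A (q n) n p f x - f x)) 0) ∧
    (∀ ν : ℝ, 0 < ν → ∀ f : ℝ → ℝ, QBaskakov.MemC ν f →
      (∀ n : ℕ, 1 ≤ n →
        (∀ x : ℝ, 0 ≤ x → QBaskakov.QBSSConverges A (q n) n p f x) ∧
        QBaskakov.BoundedOn (Set.Icc 0 ν) (fun x => QBaskakov.qBSS A (q n) n p f x - f x)) ∧
      QBaskakov.StatLim
        (fun n => QBaskakov.supNorm ν (fun x => QBaskakov.qBSS A (q n) n p f x - f x)) 0) := by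
  open QBaskakov in
  refine ⟨fun f hf => ?_, fun ν hν f hf => ?_⟩
  · obtain ⟨M, hM⟩ := hf.2
    have hM0 : 0 ≤ M := (abs_nonneg _).trans (hM 0 Set.self_mem_Ici)
    refine ⟨fun n hn => ⟨fun x hx => (qBSS_bounded hA (hq n hn).1 (hq n hn).2 hn hM hx).1,
      2 * M, fun x hx => ?_⟩, hq_one.of_two hq_int fun ε hε => ?_⟩
    · refine (qBSS_bounded hA (hq n hn).1 (hq n hn).2 hn hM hx).2.trans ?_
      exact le_mul_of_one_le_right (by positivity) (by linarith [sq_nonneg x])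
    -- The cutoff `R` satisfies `(ε / 2) R = 2 M + 1`, which exceeds the global error bound `2 M`.
    · have hR : 0 < (2 * M + 1) / (ε / 2) := by positivity
      obtain ⟨η, hη, h⟩ := qBSS_uniform_approx hA p (hf.memC ((2 * M + 1) / (ε / 2)))
        (half_pos hε)
      refine ⟨η, hη, fun n hn h1 h2 => ?_⟩
      rw [abs_of_nonneg (rhoNorm_nonneg _)]
      refine (rhoNorm_le (half_pos hε).le hR ?_
        (fun x hx => (qBSS_bounded hA (hq n hn).1 (hq n hn).2 hn hM hx).2)
        (h _ n (hq n hn).1 (hq n hn).2 hn h1 h2)).trans_lt (half_lt_self hε)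
      rw [mul_div_cancel₀ _ (half_pos hε).ne']
      linarith
  · obtain ⟨M, hM⟩ := hf.2
    refine ⟨fun n hn => ⟨fun x hx => (qBSS_bounded hA (hq n hn).1 (hq n hn).2 hn hM hx).1,
      2 * M, fun x hx => (qBSS_bounded hA (hq n hn).1 (hq n hn).2 hn hM hx.1).2⟩,
      hq_one.of_two hq_int fun ε hε => ?_⟩
    obtain ⟨η, hη, h⟩ := qBSS_uniform_approx hA p hf (half_pos hε)
    refine ⟨η, hη, fun n hn h1 h2 => ?_⟩
    rw [abs_of_nonneg (supNorm_nonneg _ _)]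
    have : Nonempty (Set.Icc (0 : ℝ) ν) := ⟨⟨0, Set.left_mem_Icc.2 hν.le⟩⟩
    exact (ciSup_le fun ⟨x, hx⟩ =>
      h _ n (hq n hn).1 (hq n hn).2 hn h1 h2 x hx).trans_lt
      (half_lt_self hε)
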